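/- Let $n\ge 0$ be an integer and write $\mathbb R[\mathbf x]$ for the ring of real polynomials in $\mathbf x=(x_1,\dots,x_n)$. Let $\Sigma[\mathbf x]$ be the set of sums of squares of polynomials in $\mathbb R[\mathbf x]$, and let $\Sigma[\mathbf x]_{d}$ be the set of those of degree at most $d$. For $g_1,\dots,g_m\in\mathbb R[\mathbf x]$ and an integer $r\ge 0$ let $$\mathcal T(g_1,\dots,g_m)_r=\Big\{\sum_{I\subseteq\{1,\dots,m\}}\sigma_I\prod_{i\in I}g_i \;:\; \sigma_I\in\Sigma[\mathbf x],\ \deg\Big(\sigma_I\prod_{i\in I}g_i\Big)\le r\ \text{ for all } I\subseteq\{1,\dots,m\}\Big\}$$ be the truncated pre-ordering of degree $r$. Theorem. Suppose that $f\in\mathbb R[\mathbf x]$ is nonnegative on $[-1,1]^n$, and let $\epsilon>0$. Then there are integers $s\ge 0$ with $$f+\epsilon\Big(1+\sum_{i=1}^n x_i^{2s}\Big)\in\Sigma[\mathbf x]_{2s};$$ let $r_\epsilon$ be the smallest of them. There exists an integer $r$ with $0\le r\le r_\epsilon$ such that $$f+(n+1)\epsilon\in\mathcal T(1-x_1,1+x_1,\dots,1-x_n,1+x_n)_{2r}.$$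 -/

import Mathlib

/-- `Σ[x]_d`: the sums of squares of real polynomials in `n` variables that have degree at most
`d`. -/
def sosTruncated (n d : ℕ) : Set (MvPolynomial (Fin n) ℝ) :=
  {p | IsSumSq p ∧ p.totalDegree ≤ d}

/-- The truncated pre-ordering `𝒯(g)_r` generated by a finite family `g` of real polynomials: all
sums `∑ I, σ I * ∏ i ∈ I, g i` over the subsets `I` of the index set, in which every `σ I` is a sum
of squares and every term has degree at most `r`. -/
def truncatedPreordering {n : ℕ} {ι : Type*} [Fintype ι]
    (g : ι → MvPolynomial (Fin n) ℝ) (r : ℕ) : Set (MvPolynomial (Fin n) ℝ) :=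
  {p | ∃ σ : Finset ι → MvPolynomial (Fin n) ℝ,
    (∀ I, IsSumSq (σ I)) ∧
    (∀ I, (σ I * ∏ i ∈ I, g i).totalDegree ≤ r) ∧
    p = ∑ I : Finset ι, σ I * ∏ i ∈ I, g i}

/-- The `2 n` generators `1 - x_i`, `1 + x_i` that describe the hypercube `[-1,1]^n`. -/
noncomputable def cubeGenerators (n : ℕ) : Fin n ⊕ Fin n → MvPolynomial (Fin n) ℝ :=
  Sum.elim (fun i => 1 - MvPolynomial.X i) (fun i => 1 + MvPolynomial.X i)

/-- The perturbation `f + ε (1 + ∑ i, x_i ^ (2 s))`. -/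
noncomputable def sosPerturbation {n : ℕ} (f : MvPolynomial (Fin n) ℝ) (ε : ℝ) (s : ℕ) :
    MvPolynomial (Fin n) ℝ :=
  f + MvPolynomial.C ε * (1 + ∑ i : Fin n, MvPolynomial.X i ^ (2 * s))

/-! For any admissible `s`, `f + (n + 1) ε` is the perturbation of `f` plus the terms `ε (1 - x_i ^
(2 s))`, and `1 - x_i ^ (2 s)` is `(1 - x_i) (1 + x_i)` times a sum of squares. So `r = rε` works
once an admissible `s` exists.

Existence is proved algebraically. The polynomials satisfying `IsSumSqLimit` form a cone closed
under multiplication by sums of squares and, crucially, by `1 - x_i ^ 2` (`one_sub_sq_mul`), hence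
by `1 ± x_i`. A polynomial positive on the cube has nonnegative Bernstein coefficients in high
degree, so it lies in this cone (`isSumSqLimit_of_pos`); a small added constant reduces the
nonnegative case to this one. -/

open MvPolynomial

/-! ### Elementary inequalities as sum-of-squares identities -/

section SumSq

variable {R : Type*} [CommRing R]

theorem isSumSq_pow {y : R} (hy : IsSumSq y) (k : ℕ) : IsSumSq (y ^ k) := by
  induction k with
  | zero => simp
  | succ k ih => rw [pow_succ]; exact ih.mul hy

theorem isSumSq_sq (y : R) : IsSumSq (y ^ 2) := by
  rw [sq]; exact IsSumSq.mul_self y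

/-- A form of the inequality between the arithmetic and the geometric mean. -/
theorem isSumSq_pow_add_sub_mul {y z : R} (hy : IsSumSq y) (hz : IsSumSq z) (p q : ℕ) :
    IsSumSq (y ^ (p + q) + z ^ (p + q) - y ^ p * z ^ q) := by
  have hg (k : ℕ) : IsSumSq (∑ i ∈ Finset.range k, y ^ i * z ^ (k - 1 - i)) :=
    IsSumSq.sum fun i _ => (isSumSq_pow hy i).mul (isSumSq_pow hz _)
  -- The product is `(y ^ p - z ^ p) * (y ^ q - z ^ q)`: both factors are divisible by `y - z`, with
  -- sums of squares as quotients.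
  have h : y ^ (p + q) + z ^ (p + q) - y ^ p * z ^ q =
      (y - z) ^ 2 * ((∑ i ∈ Finset.range p, y ^ i * z ^ (p - 1 - i)) *
        (∑ i ∈ Finset.range q, y ^ i * z ^ (q - 1 - i))) + y ^ q * z ^ p := by
    have e : (y - z) ^ 2 * ((∑ i ∈ Finset.range p, y ^ i * z ^ (p - 1 - i)) *
        (∑ i ∈ Finset.range q, y ^ i * z ^ (q - 1 - i))) =
        ((∑ i ∈ Finset.range p, y ^ i * z ^ (p - 1 - i)) * (y - z)) *
        ((∑ i ∈ Finset.range q, y ^ i * z ^ (q - 1 - i)) * (y - z)) := by ring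
    rw [e, geom_sum₂_mul, geom_sum₂_mul]; ring
  rw [h]
  exact ((isSumSq_sq _).mul ((hg p).mul (hg q))).add
    ((isSumSq_pow hy q).mul (isSumSq_pow hz p))

/-- Bernoulli's inequality. -/
theorem isSumSq_bernoulli {t : R} (ht : IsSumSq t) (s : ℕ) :
    IsSumSq (t ^ s - 1 - (s : R) * (t - 1)) := by
  induction s with
  | zero => simp
  | succ s ih =>
    have h : t ^ (s + 1) - 1 - ((s + 1 : ℕ) : R) * (t - 1) =
        t * (t ^ s - 1 - (s : R) * (t - 1)) + (s : R) * (t - 1) ^ 2 := by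
      push_cast; ring
    rw [h]
    exact (ht.mul ih).add ((IsSumSq.natCast s).mul (isSumSq_sq _))

theorem isSumSq_of_eq {p q : R} (hp : IsSumSq p) (h : q = p) : IsSumSq q := h ▸ hp

end SumSq

variable {n : ℕ}

theorem isSumSq_C {a : ℝ} (ha : 0 ≤ a) : IsSumSq (C a : MvPolynomial (Fin n) ℝ) := by
  rw [← Real.mul_self_sqrt ha, C_mul]; exact IsSumSq.mul_self _

/-- If `δ ≥ 1 / m`, then `1 - t + δ (1 + t ^ m)` is a sum of squares. -/
theorem isSumSq_one_sub_add {t : MvPolynomial (Fin n) ℝ} (ht : IsSumSq t) {δ : ℝ} {m : ℕ}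
    (hm : 1 ≤ m * δ) : IsSumSq (1 - t + C δ * (1 + t ^ m)) := by
  have hm0 : (0 : ℝ) < m := by
    rcases Nat.eq_zero_or_pos m with rfl | h
    · norm_num at hm
    · exact_mod_cast h
  have e : (C (1 / (m : ℝ)) : MvPolynomial (Fin n) ℝ) * (m : MvPolynomial (Fin n) ℝ) = 1 := by
    rw [← map_natCast C m, ← C_mul, one_div, inv_mul_cancel₀ hm0.ne', C_1]
  have hle : 1 / (m : ℝ) ≤ δ := by
    rw [div_le_iff₀ hm0]; linarith
  have h : 1 - t + C δ * (1 + t ^ m) =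
      C (1 / (m : ℝ)) * (t ^ m - 1 - (m : MvPolynomial (Fin n) ℝ) * (t - 1)) +
        C (1 / (m : ℝ)) * 2 + C (δ - 1 / (m : ℝ)) * (1 + t ^ m) := by
    rw [C_sub]
    linear_combination (t - 1) * e
  have h2 : IsSumSq (2 : MvPolynomial (Fin n) ℝ) := by
    exact_mod_cast IsSumSq.natCast (R := MvPolynomial (Fin n) ℝ) 2
  rw [h]
  exact (((isSumSq_C (by positivity)).mul (isSumSq_bernoulli ht m)).add
    ((isSumSq_C (by positivity)).mul h2)).add
    ((isSumSq_C (by linarith)).mul (IsSumSq.one.add (isSumSq_pow ht m)))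

/-! ### Domination by power sums -/

/-- The squares of the variables, with `1` added as a further variable. -/
noncomputable def sqVar (o : Option (Fin n)) : MvPolynomial (Fin n) ℝ :=
  o.elim 1 fun i => X i ^ 2

theorem isSumSq_sqVar (o : Option (Fin n)) : IsSumSq (sqVar o) := by
  cases o
  · exact IsSumSq.one
  · exact isSumSq_sq _

/-- The polynomial `1 + ∑ i, x_i ^ (2 s)`. -/
noncomputable def powerSum (n s : ℕ) : MvPolynomial (Fin n) ℝ :=
  ∑ o : Option (Fin n), sqVar o ^ s

theorem powerSum_eq (n s : ℕ) :
    powerSum n s = 1 + ∑ i : Fin n, (X i : MvPolynomial (Fin n) ℝ) ^ (2 * s) := by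
  simp [powerSum, Fintype.sum_option, sqVar, pow_mul]

theorem isSumSq_powerSum (n s : ℕ) : IsSumSq (powerSum n s) :=
  IsSumSq.sum fun o _ => isSumSq_pow (isSumSq_sqVar o) s

theorem isSumSq_powerSum_sub_one (n s : ℕ) : IsSumSq (powerSum n s - 1) := by
  rw [powerSum_eq, add_sub_cancel_left]
  exact IsSumSq.sum fun i _ => by rw [pow_mul]; exact isSumSq_pow (isSumSq_sq _) s

theorem isSumSq_powerSum_sub_X (s : ℕ) (i : Fin n) :
    IsSumSq (powerSum n s - (1 + (X i ^ 2) ^ s)) := by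
  rw [powerSum_eq, add_sub_add_left_eq_sub, ← Finset.add_sum_erase _ _ (Finset.mem_univ i),
    ← pow_mul, add_sub_cancel_left]
  exact IsSumSq.sum fun i _ => by rw [pow_mul]; exact isSumSq_pow (isSumSq_sq _) s

/-- Sum the mean inequality over all pairs of the `n + 1` indices: each of its two pure powers is
counted `n + 1` times. -/
theorem isSumSq_powerSum_mul (n a b : ℕ) :
    IsSumSq (C (2 * ((n : ℝ) + 1)) * powerSum n (a + b) - powerSum n a * powerSum n b) := by
  have h : C (2 * ((n : ℝ) + 1)) * powerSum n (a + b) - powerSum n a * powerSum n b =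
      ∑ o : Option (Fin n), ∑ o' : Option (Fin n),
        (sqVar o ^ (a + b) + sqVar o' ^ (a + b) - sqVar o ^ a * sqVar o' ^ b) := by
    simp only [powerSum, Finset.sum_sub_distrib, Finset.sum_add_distrib, Finset.sum_mul_sum,
      Finset.sum_const, ← Finset.smul_sum]
    simp only [Finset.card_univ, Fintype.card_option, Fintype.card_fin, nsmul_eq_mul, C_mul, C_add,
      C_1, map_natCast, map_ofNat, Nat.cast_add, Nat.cast_one]
    ring
  rw [h]
  exact IsSumSq.sum fun o _ => IsSumSq.sum fun o' _ =>
    isSumSq_pow_add_sub_mul (isSumSq_sqVar o) (isSumSq_sqVar o') a b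

theorem isSumSq_powerSum_mono {a b : ℕ} (hab : a ≤ b) :
    IsSumSq (C (2 * ((n : ℝ) + 1)) * powerSum n b - powerSum n a) := by
  obtain ⟨c, rfl⟩ := Nat.exists_eq_add_of_le hab
  have h : C (2 * ((n : ℝ) + 1)) * powerSum n (a + c) - powerSum n a =
      (C (2 * ((n : ℝ) + 1)) * powerSum n (a + c) - powerSum n a * powerSum n c) +
        powerSum n a * (powerSum n c - 1) := by ring
  rw [h]
  exact (isSumSq_powerSum_mul n a c).add
    ((isSumSq_powerSum n a).mul (isSumSq_powerSum_sub_one n c))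

/-- Bounding `f ^ 2` instead of `f` lets the induction pass through `X i`, whose sign is unknown but
whose square is a sum of squares. -/
theorem exists_isSumSq_sub_sq (f : MvPolynomial (Fin n) ℝ) :
    ∃ K : ℝ, 0 ≤ K ∧ ∃ d : ℕ, IsSumSq (C K * powerSum n d - f ^ 2) := by
  induction f using MvPolynomial.induction_on with
  | C a =>
    refine ⟨a ^ 2, sq_nonneg a, 0, ?_⟩
    have h : C (a ^ 2) * powerSum n 0 - C a ^ 2 = C a ^ 2 * (powerSum n 0 - 1) := by
      rw [C_pow]; ring
    rw [h]
    exact (isSumSq_sq _).mul (isSumSq_powerSum_sub_one n 0)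
  | add f g hf hg =>
    obtain ⟨K, hK, d, hf⟩ := hf
    obtain ⟨L, hL, e, hg⟩ := hg
    refine ⟨2 * (2 * ((n : ℝ) + 1)) * (K + L), by positivity, max d e, ?_⟩
    have hd := (isSumSq_C (n := n) hK).mul (isSumSq_powerSum_mono (n := n) (le_max_left d e))
    have he := (isSumSq_C (n := n) hL).mul (isSumSq_powerSum_mono (n := n) (le_max_right d e))
    have h2 := ((hd.add he).add (hf.add hg))
    have h := (h2.add h2).add (isSumSq_sq (f - g))
    refine isSumSq_of_eq (h) ?_
    simp only [C_mul, C_add, map_ofNat]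
    ring
  | mul_X f i hf =>
    obtain ⟨K, hK, d, hf⟩ := hf
    refine ⟨K * (2 * ((n : ℝ) + 1)), by positivity, d + 1, ?_⟩
    have h1 := (isSumSq_C (n := n) hK).mul (isSumSq_powerSum_mul n d 1)
    have h2 := ((isSumSq_C (n := n) hK).mul (isSumSq_powerSum n d)).mul
      ((isSumSq_powerSum_sub_X 1 i).add IsSumSq.one)
    have h3 := hf.mul (isSumSq_sq (X i))
    refine isSumSq_of_eq ((h1.add h2).add h3) ?_
    simp only [C_mul]
    ring

/-- Every polynomial is dominated by a multiple of some `powerSum n d`. -/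
theorem exists_isSumSq_sub (f : MvPolynomial (Fin n) ℝ) :
    ∃ K : ℝ, 0 ≤ K ∧ ∃ d : ℕ, IsSumSq (C K * powerSum n d - f) := by
  obtain ⟨K, hK, d, h⟩ := exists_isSumSq_sub_sq f
  refine ⟨K + 1, by positivity, d, ?_⟩
  have e : C (K + 1) * powerSum n d - f =
      (C K * powerSum n d - f ^ 2) + (powerSum n d - 1) + (f - C (1 / 2)) ^ 2 + C (3 / 4) := by
    have h4 : (C (3 / 4) : MvPolynomial (Fin n) ℝ) = 1 - C (1 / 2) ^ 2 := by
      rw [← C_pow, ← C_1, ← C_sub]; norm_num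
    have h2 : (C (1 / 2) : MvPolynomial (Fin n) ℝ) * 2 = 1 := by
      rw [← map_ofNat C 2, ← C_mul]; norm_num
    rw [h4, C_add, C_1]
    linear_combination f * h2
  rw [e]
  exact ((h.add (isSumSq_powerSum_sub_one n d)).add (isSumSq_sq _)).add
    (isSumSq_C (by norm_num))

/-! ### The cone of limits of sums of squares -/

/-- The polynomials that every small multiple of some `powerSum n s` makes a sum of squares. -/
def IsSumSqLimit (f : MvPolynomial (Fin n) ℝ) : Prop :=
  ∀ ε : ℝ, 0 < ε → ∃ s : ℕ, IsSumSq (f + C ε * powerSum n s)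

namespace IsSumSqLimit

variable {f g : MvPolynomial (Fin n) ℝ}

/-- Power sums increase with `s` only up to the factor `2 (n + 1)`, so `ε` is divided by it
beforehand. This lets two members share one exponent. -/
theorem exists_forall_ge (hf : IsSumSqLimit f) {ε : ℝ} (hε : 0 < ε) :
    ∃ s₀ : ℕ, ∀ s, s₀ ≤ s → IsSumSq (f + C ε * powerSum n s) := by
  have hK : (0 : ℝ) < 2 * ((n : ℝ) + 1) := by positivity
  obtain ⟨s₀, h⟩ := hf (ε / (2 * ((n : ℝ) + 1))) (by positivity)
  refine ⟨s₀, fun s hs => ?_⟩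
  refine isSumSq_of_eq (h.add ((isSumSq_C (n := n) (a := ε / (2 * ((n : ℝ) + 1))) (by positivity)).mul
    (isSumSq_powerSum_mono (n := n) hs))) ?_
  have e : C ε = C (ε / (2 * ((n : ℝ) + 1))) * (C (2 * ((n : ℝ) + 1)) : MvPolynomial (Fin n) ℝ) := by
    rw [← C_mul, div_mul_cancel₀ _ hK.ne']
  rw [e]; ring

theorem of_isSumSq (hf : IsSumSq f) : IsSumSqLimit f := fun _ hε =>
  ⟨0, hf.add ((isSumSq_C hε.le).mul (isSumSq_powerSum n 0))⟩

theorem add (hf : IsSumSqLimit f) (hg : IsSumSqLimit g) : IsSumSqLimit (f + g) := by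
  intro ε hε
  obtain ⟨s, hs⟩ := hf.exists_forall_ge (half_pos hε)
  obtain ⟨t, ht⟩ := hg.exists_forall_ge (half_pos hε)
  refine ⟨max s t, ?_⟩
  refine isSumSq_of_eq ((hs _ (le_max_left s t)).add (ht _ (le_max_right s t))) ?_
  nth_rewrite 1 [← add_halves ε]
  rw [C_add]; ring

theorem sum {ι : Type*} {I : Finset ι} {F : ι → MvPolynomial (Fin n) ℝ}
    (h : ∀ i ∈ I, IsSumSqLimit (F i)) : IsSumSqLimit (∑ i ∈ I, F i) :=
  Finset.sum_induction _ _ (fun _ _ => add) (of_isSumSq IsSumSq.zero) h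

theorem of_forall_add_C (h : ∀ η : ℝ, 0 < η → IsSumSqLimit (f + C η)) : IsSumSqLimit f := by
  intro ε hε
  obtain ⟨s, hs⟩ := h (ε / 2) (half_pos hε) (ε / 2) (half_pos hε)
  refine ⟨s, ?_⟩
  refine isSumSq_of_eq (hs.add ((isSumSq_C (n := n) (half_pos hε).le).mul (isSumSq_powerSum_sub_one n s))) ?_
  nth_rewrite 1 [← add_halves ε]
  rw [C_add]; ring

theorem isSumSq_mul (hf : IsSumSqLimit f) (hg : IsSumSq g) : IsSumSqLimit (g * f) := by
  intro ε hε
  obtain ⟨K, hK, d, hd⟩ := exists_isSumSq_sub g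
  set M : ℝ := 2 * ((n : ℝ) + 1) with hM
  have hM0 : 0 < M := by positivity
  set δ : ℝ := ε / ((K + 1) * M) with hδ
  have hδ0 : 0 < δ := by positivity
  obtain ⟨s, hs⟩ := hf δ hδ0
  refine ⟨d + s, ?_⟩
  have h1 := hg.mul hs
  have h2 := (isSumSq_C (n := n) hδ0.le).mul (hd.mul (isSumSq_powerSum n s))
  have h3 := (isSumSq_C (n := n) (mul_nonneg hδ0.le hK)).mul (isSumSq_powerSum_mul n d s)
  have h4 := (isSumSq_C (n := n) (mul_nonneg hδ0.le hM0.le)).mul (isSumSq_powerSum n (d + s))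
  have e : ε = δ * K * M + δ * M := by rw [hδ]; field_simp
  rw [e]
  refine isSumSq_of_eq (((h1.add h2).add h3).add h4) ?_
  simp only [C_add, C_mul, ← hM]
  ring

/-- With `F = f + α P_s` a sum of squares, `(1 - x ^ 2) F` becomes one after adding `δ (1 + x ^ (2
m)) F`, where `m ≥ 1 / δ`. That correction is at most `δ P_m F ≤ δ K P_m P_d`. As `K` and `d` depend
only on `F`, `δ` can be chosen after them, and `m` last. -/
theorem one_sub_sq_mul (hf : IsSumSqLimit f) (i : Fin n) :
    IsSumSqLimit ((1 - X i ^ 2) * f) := by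
  intro ε hε
  set M : ℝ := 2 * ((n : ℝ) + 1) with hM
  have hM0 : 0 < M := by positivity
  set α : ℝ := ε / (2 * M) with hα
  have hα0 : 0 < α := by positivity
  obtain ⟨s, hs⟩ := hf α hα0
  obtain ⟨K, hK, d, hd⟩ := exists_isSumSq_sub (f + C α * powerSum n s)
  set δ : ℝ := ε / (2 * ((K + 1) * M * M)) with hδ
  have hδ0 : 0 < δ := by positivity
  obtain ⟨m, hm⟩ := exists_nat_gt (1 / δ)
  have hm1 : 1 ≤ m * δ := by
    rw [div_lt_iff₀ hδ0] at hm; exact hm.le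
  have hX : IsSumSq ((X i : MvPolynomial (Fin n) ℝ) ^ 2) := isSumSq_sq _
  refine ⟨s + (m + d), ?_⟩
  have hN := isSumSq_powerSum n (s + (m + d))
  have h1 := (isSumSq_one_sub_add hX hm1).mul hs
  have h2 := (isSumSq_C (n := n) hα0.le).mul (hX.mul (isSumSq_powerSum n s))
  have h3 := (isSumSq_C (n := n) hα0.le).mul
    (isSumSq_powerSum_mono (n := n) (Nat.le_add_right s (m + d)))
  have h4 := (isSumSq_C (n := n) hδ0.le).mul ((isSumSq_powerSum_sub_X m i).mul hs)
  have h5 := (isSumSq_C (n := n) hδ0.le).mul ((isSumSq_powerSum n m).mul hd)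
  have h6 := (isSumSq_C (n := n) (mul_nonneg hδ0.le hK)).mul (isSumSq_powerSum_mul n m d)
  have h7 := (isSumSq_C (n := n) (mul_nonneg (mul_nonneg hδ0.le hK) hM0.le)).mul
    (isSumSq_powerSum_mono (n := n) (Nat.le_add_left (m + d) s))
  have h8 := (isSumSq_C (n := n) (mul_nonneg (mul_nonneg hδ0.le hM0.le) hM0.le)).mul hN
  -- Half of `ε` pays for `α P_s`, the other half for the correction; using `K + 1` in `δ` avoids
  -- dividing by zero and leaves the slack `h8`.
  have e : ε = α * M + δ * K * M * M + δ * M * M := by rw [hδ, hα]; field_simp; ring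
  rw [e]
  refine isSumSq_of_eq (((((((h1.add h2).add h3).add h4).add h5).add h6).add h7).add h8) ?_
  simp only [C_add, C_mul, ← hM]
  ring

/-- `2 (1 - x) = (1 - x) ^ 2 + (1 - x ^ 2)`. -/
theorem one_sub_mul (hf : IsSumSqLimit f) (i : Fin n) : IsSumSqLimit ((1 - X i) * f) := by
  have h := ((hf.isSumSq_mul (isSumSq_sq (1 - X i))).add (hf.one_sub_sq_mul i)).isSumSq_mul
    (isSumSq_C (n := n) (a := 1 / 2) (by norm_num))
  have h2 : (C (1 / 2) : MvPolynomial (Fin n) ℝ) * 2 = 1 := by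
    rw [← map_ofNat C 2, ← C_mul]; norm_num
  convert h using 1
  linear_combination (-(1 - X i) * f) * h2

theorem one_add_mul (hf : IsSumSqLimit f) (i : Fin n) : IsSumSqLimit ((1 + X i) * f) := by
  have h := ((hf.isSumSq_mul (isSumSq_sq (1 + X i))).add (hf.one_sub_sq_mul i)).isSumSq_mul
    (isSumSq_C (n := n) (a := 1 / 2) (by norm_num))
  have h2 : (C (1 / 2) : MvPolynomial (Fin n) ℝ) * 2 = 1 := by
    rw [← map_ofNat C 2, ← C_mul]; norm_num
  convert h using 1
  linear_combination (-(1 + X i) * f) * h2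

theorem prod_mul (hf : IsSumSqLimit f) (a b : Fin n → ℕ) :
    IsSumSqLimit ((∏ i, ((1 + X i) ^ a i * (1 - X i) ^ b i)) * f) := by
  have hpow (g h : MvPolynomial (Fin n) ℝ) (hg : ∀ f, IsSumSqLimit f → IsSumSqLimit (g * f))
      (hh : IsSumSqLimit h) (k : ℕ) : IsSumSqLimit (g ^ k * h) := by
    induction k with
    | zero => simpa using hh
    | succ k ih => rw [pow_succ', mul_assoc]; exact hg _ ih
  induction (Finset.univ : Finset (Fin n)) using Finset.induction_on with
  | empty => simpa using hf
  | insert i I hi ih =>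
    rw [Finset.prod_insert hi, mul_assoc, mul_assoc]
    exact hpow _ _ (fun _ h => h.one_add_mul i)
      (hpow _ _ (fun _ h => h.one_sub_mul i) ih _) _

end IsSumSqLimit

/-! ### Bernstein coefficients and positivity on the cube -/

/-- The coefficient of `v ^ k` in the Bernstein basis of degree `N`. -/
noncomputable def bernsteinRatio (N k j : ℕ) : ℝ := (j.choose k : ℝ) / (N.choose k : ℝ)

theorem bernsteinRatio_mem_Icc {N j : ℕ} (k : ℕ) (hj : j ≤ N) :
    bernsteinRatio N k j ∈ Set.Icc (0 : ℝ) 1 := by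
  refine ⟨by unfold bernsteinRatio; positivity, div_le_one_of_le₀ ?_ (by positivity)⟩
  exact_mod_cast Nat.choose_le_choose k hj

theorem abs_sub_div_sub_div_le {N k j : ℕ} (hk : k < N) (hj : j ≤ N) :
    |((j - k : ℕ) : ℝ) / ((N - k : ℕ) : ℝ) - j / N| ≤ k / N := by
  have hN : (0 : ℝ) < N := by exact_mod_cast (Nat.zero_le k).trans_lt hk
  have hNk : (0 : ℝ) < (N : ℝ) - k := by rw [sub_pos]; exact_mod_cast hk
  have hjN : (j : ℝ) ≤ N := by exact_mod_cast hj
  rcases le_total k j with h | h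
  · have hkj : (k : ℝ) ≤ j := by exact_mod_cast h
    rw [Nat.cast_sub h, Nat.cast_sub hk.le]
    have e : ((j : ℝ) - k) / (N - k) - j / N = -(k / N * ((N - j) / (N - k))) := by
      field_simp; ring
    rw [e, abs_neg, abs_of_nonneg (by have := sub_nonneg.2 hjN; positivity)]
    refine mul_le_of_le_one_right (by positivity) ?_
    rw [div_le_one hNk]; linarith
  · rw [Nat.sub_eq_zero_of_le h, Nat.cast_zero, zero_div, zero_sub, abs_neg,
      abs_of_nonneg (by positivity)]
    gcongr

theorem abs_mul_sub_mul_le {a b c d : ℝ} (ha : a ∈ Set.Icc (0 : ℝ) 1) (hd : d ∈ Set.Icc (0 : ℝ) 1) :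
    |a * b - c * d| ≤ |a - c| + |b - d| := by
  have e : a * b - c * d = a * (b - d) + (a - c) * d := by ring
  rw [e]
  refine (abs_add_le _ _).trans ?_
  rw [abs_mul, abs_mul, abs_of_nonneg ha.1, abs_of_nonneg hd.1, add_comm]
  exact add_le_add (mul_le_of_le_one_right (abs_nonneg _) hd.2)
    (mul_le_of_le_one_left (abs_nonneg _) ha.2)

theorem abs_prod_sub_prod_le {ι : Type*} (I : Finset ι) {a b : ι → ℝ}
    (ha : ∀ i, a i ∈ Set.Icc (0 : ℝ) 1) (hb : ∀ i, b i ∈ Set.Icc (0 : ℝ) 1) :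
    |∏ i ∈ I, a i - ∏ i ∈ I, b i| ≤ ∑ i ∈ I, |a i - b i| := by
  classical
  induction I using Finset.induction_on with
  | empty => simp
  | insert i I hi ih =>
    rw [Finset.prod_insert hi, Finset.prod_insert hi, Finset.sum_insert hi, mul_comm (b i)]
    rw [mul_comm (∏ i ∈ I, b i)]
    have hprod : ∏ i ∈ I, b i ∈ Set.Icc (0 : ℝ) 1 :=
      ⟨Finset.prod_nonneg fun i _ => (hb i).1,
        Finset.prod_le_one (fun i _ => (hb i).1) fun i _ => (hb i).2⟩
    exact (abs_mul_sub_mul_le (ha i) hprod).trans (by gcongr)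

/-- The ratio is a product of factors `(j - i) / (N - i)` for `i < k`, each within `i / N` of `j /
N`. -/
theorem abs_bernsteinRatio_sub_le {N j : ℕ} (hj : j ≤ N) {k : ℕ} (hk : k ≤ N) :
    |bernsteinRatio N k j - ((j : ℝ) / N) ^ k| ≤ (k : ℝ) ^ 2 / N := by
  induction k with
  | zero => simp [bernsteinRatio]
  | succ k ih =>
    have hk' : k < N := hk
    have hx : (j : ℝ) / N ∈ Set.Icc (0 : ℝ) 1 :=
      ⟨by positivity, div_le_one_of_le₀ (by exact_mod_cast hj) (by positivity)⟩
    have e : bernsteinRatio N (k + 1) j =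
        bernsteinRatio N k j * (((j - k : ℕ) : ℝ) / ((N - k : ℕ) : ℝ)) := by
      have h (m : ℕ) : (m.choose (k + 1) : ℝ) = m.choose k * ((m - k : ℕ) : ℝ) / (k + 1) := by
        rw [eq_div_iff (by positivity)]
        exact_mod_cast Nat.choose_succ_right_eq m k
      unfold bernsteinRatio
      rw [h j, h N, div_div_div_cancel_right₀ (by positivity), mul_div_mul_comm]
    rw [e, pow_succ]
    refine (abs_mul_sub_mul_le (bernsteinRatio_mem_Icc k hj) hx).trans ?_
    refine (add_le_add (ih hk'.le) (abs_sub_div_sub_div_le hk' hj)).trans ?_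
    rw [← add_div]
    gcongr
    push_cast
    nlinarith [(Nat.cast_nonneg k : (0 : ℝ) ≤ k)]

/-- The expansion of a power in the Bernstein basis. -/
theorem pow_eq_sum_bernstein {u v : MvPolynomial (Fin n) ℝ} (huv : v + u = 1) {N k : ℕ}
    (hk : k ≤ N) :
    v ^ k = ∑ j ∈ Finset.range (N + 1),
      C (bernsteinRatio N k j) * ((N.choose j : MvPolynomial (Fin n) ℝ) * (v ^ j * u ^ (N - j))) := by
  obtain ⟨l, rfl⟩ := Nat.exists_eq_add_of_le hk
  -- Terms with `j < k` have coefficient zero; the others come from expanding `v ^ k * (v + u) ^ (N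
  -- - k)`.
  rw [add_assoc, Finset.sum_range_add, Finset.sum_eq_zero, zero_add]
  · calc v ^ k = v ^ k * (v + u) ^ l := by rw [huv, one_pow, mul_one]
      _ = _ := by
        rw [add_pow, Finset.mul_sum]
        refine Finset.sum_congr rfl fun m hm => ?_
        have hml : m ≤ l := Nat.lt_succ_iff.1 (Finset.mem_range.1 hm)
        have h : (C (bernsteinRatio (k + l) k (k + m)) : MvPolynomial (Fin n) ℝ) *
            ((k + l).choose (k + m) : MvPolynomial (Fin n) ℝ) = (l.choose m : MvPolynomial (Fin n) ℝ) := by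
          rw [← map_natCast C, ← map_natCast C, ← C_mul]
          congr 1
          have h0 : (((k + l).choose k : ℕ) : ℝ) ≠ 0 := by
            exact_mod_cast (Nat.choose_pos (Nat.le_add_right k l)).ne'
          have h1 := Nat.choose_mul (n := k + l) (k := k + m) (s := k) (Nat.le_add_right k m)
          rw [Nat.add_sub_cancel_left, Nat.add_sub_cancel_left] at h1
          unfold bernsteinRatio
          rw [div_mul_eq_mul_div, div_eq_iff h0, mul_comm, mul_comm (l.choose m : ℝ)]
          exact_mod_cast h1
        rw [← h, Nat.add_sub_add_left, pow_add]
        ring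
  · intro j hj
    rw [bernsteinRatio, Nat.choose_eq_zero_of_lt (Finset.mem_range.1 hj)]
    simp

theorem abs_sum_bernsteinRatio_sub_le (p : MvPolynomial (Fin n) ℝ) {N : ℕ}
    (hN : p.totalDegree ≤ N) {J : Fin n → ℕ} (hJ : ∀ i, J i ≤ N) :
    |∑ α ∈ p.support, p.coeff α * ∏ i, bernsteinRatio N (α i) (J i) -
        eval (fun i => (J i : ℝ) / N) p| ≤
      (∑ α ∈ p.support, |p.coeff α| * ∑ i, (α i : ℝ) ^ 2) / N := by
  rw [eval_eq', ← Finset.sum_sub_distrib, Finset.sum_div]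
  refine (Finset.abs_sum_le_sum_abs _ _).trans (Finset.sum_le_sum fun α hα => ?_)
  rw [← mul_sub, abs_mul, mul_div_assoc, Finset.sum_div]
  refine mul_le_mul_of_nonneg_left ?_ (abs_nonneg _)
  refine (abs_prod_sub_prod_le _ (fun i => bernsteinRatio_mem_Icc _ (hJ i)) fun i => ?_).trans
    (Finset.sum_le_sum fun i _ => abs_bernsteinRatio_sub_le (hJ i) ?_)
  · exact ⟨by positivity, pow_le_one₀ (by positivity)
      (div_le_one_of_le₀ (by exact_mod_cast hJ i) (by positivity))⟩
  · refine le_trans ?_ ((le_totalDegree hα).trans hN)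
    rw [Finsupp.sum_fintype _ _ fun _ => rfl]
    exact Finset.single_le_sum (f := fun i => α i) (fun _ _ => Nat.zero_le _) (Finset.mem_univ i)

/-- After moving the cube to `[0,1]^n`, each Bernstein coefficient differs from a grid value, which
is at least `η`, by at most `S / N`; so it is nonnegative once `N ≥ S / η`. -/
theorem isSumSqLimit_of_pos {f : MvPolynomial (Fin n) ℝ} {η : ℝ} (hη : 0 < η)
    (hf : ∀ x : Fin n → ℝ, (∀ i, x i ∈ Set.Icc (-1 : ℝ) 1) → η ≤ eval x f) :
    IsSumSqLimit f := by
  set p : MvPolynomial (Fin n) ℝ := bind₁ (fun i => 2 * X i - 1) f with hp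
  set v : Fin n → MvPolynomial (Fin n) ℝ := fun i => C (1 / 2) * (1 + X i) with hv
  set u : Fin n → MvPolynomial (Fin n) ℝ := fun i => C (1 / 2) * (1 - X i) with hu
  have h2 : (C (1 / 2) : MvPolynomial (Fin n) ℝ) * 2 = 1 := by
    rw [← map_ofNat C 2, ← C_mul]; norm_num
  have huv (i) : v i + u i = 1 := by simp only [hu, hv]; linear_combination h2
  have hfp : f = ∑ α ∈ p.support, C (p.coeff α) * ∏ i, v i ^ α i := by
    have h : bind₁ v p = f := by
      rw [hp, bind₁_bind₁]
      have e : (fun i => bind₁ v (2 * X i - 1)) = (X : Fin n → MvPolynomial (Fin n) ℝ) := by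
        funext i
        simp only [map_sub, map_mul, map_ofNat, map_one, bind₁_X_right, hv]
        linear_combination (1 + X i) * h2
      rw [e, bind₁_X_left, AlgHom.id_apply]
    nth_rewrite 1 [← h]
    rw [bind₁, aeval_def, eval₂_eq']
    rfl
  have hpos (y : Fin n → ℝ) (hy : ∀ i, y i ∈ Set.Icc (0 : ℝ) 1) : η ≤ eval y p := by
    have h : eval y p = eval (fun i => 2 * y i - 1) f := by
      have hC : (eval y).comp C = RingHom.id ℝ := RingHom.ext fun a => eval_C a
      have hX : (fun i => eval y (2 * X i - 1)) = fun i => 2 * y i - 1 := by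
        funext i
        simp
      rw [hp, hom_bind₁, hC, hX, eval]
    rw [h]
    exact hf _ fun i => ⟨by linarith [(hy i).1], by linarith [(hy i).2]⟩
  set S : ℝ := ∑ α ∈ p.support, |p.coeff α| * ∑ i, (α i : ℝ) ^ 2 with hS
  obtain ⟨m, hm⟩ := exists_nat_gt (S / η)
  set N : ℕ := max m (p.totalDegree + 1)
  have hN : p.totalDegree ≤ N := (Nat.le_succ _).trans (le_max_right _ _)
  have hN0 : (0 : ℝ) < N := by
    exact_mod_cast (Nat.succ_pos _).trans_le (le_max_right m (p.totalDegree + 1))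
  have hSN : S / N ≤ η := by
    rw [div_le_iff₀ hN0]
    rw [div_lt_iff₀ hη] at hm
    have : (m : ℝ) ≤ N := by exact_mod_cast le_max_left _ _
    nlinarith
  have hexp : f = ∑ J ∈ Fintype.piFinset fun _ : Fin n => Finset.range (N + 1),
      C (∑ α ∈ p.support, p.coeff α * ∏ i, bernsteinRatio N (α i) (J i)) *
        ∏ i, ((N.choose (J i) : MvPolynomial (Fin n) ℝ) * (v i ^ J i * u i ^ (N - J i))) := by
    nth_rewrite 1 [hfp]
    simp only [map_sum, Finset.sum_mul]
    rw [Finset.sum_comm]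
    refine Finset.sum_congr rfl fun α hα => ?_
    have hαN (i : Fin n) : α i ≤ N := by
      refine le_trans ?_ ((le_totalDegree hα).trans hN)
      rw [Finsupp.sum_fintype _ _ fun _ => rfl]
      exact Finset.single_le_sum (f := fun i => α i) (fun _ _ => Nat.zero_le _) (Finset.mem_univ i)
    rw [Finset.prod_congr rfl fun i _ => pow_eq_sum_bernstein (huv i) (hαN i),
      Finset.prod_univ_sum, Finset.mul_sum]
    refine Finset.sum_congr rfl fun J _ => ?_
    rw [Finset.prod_mul_distrib, C_mul, map_prod, mul_assoc]
  rw [hexp]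
  refine IsSumSqLimit.sum fun J hJ => ?_
  have hJN (i : Fin n) : J i ≤ N :=
    Nat.lt_succ_iff.1 (Finset.mem_range.1 (Fintype.mem_piFinset.1 hJ i))
  have hcoeff : 0 ≤ ∑ α ∈ p.support, p.coeff α * ∏ i, bernsteinRatio N (α i) (J i) := by
    have h1 := abs_sum_bernsteinRatio_sub_le p hN hJN
    have h2 := hpos (fun i => (J i : ℝ) / N) fun i =>
      ⟨by positivity, div_le_one_of_le₀ (by exact_mod_cast hJN i) hN0.le⟩
    have h3 := (abs_le.1 h1).1
    linarith
  -- The trailing `1` is the member of the cone to which `prod_mul` is applied.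
  have e : ∏ i, ((N.choose (J i) : MvPolynomial (Fin n) ℝ) * (v i ^ J i * u i ^ (N - J i))) =
      (∏ i, ((N.choose (J i) : MvPolynomial (Fin n) ℝ) *
        (C (1 / 2) ^ J i * C (1 / 2) ^ (N - J i)))) *
      ((∏ i, ((1 + X i) ^ J i * (1 - X i) ^ (N - J i))) * 1) := by
    rw [mul_one, ← Finset.prod_mul_distrib]
    refine Finset.prod_congr rfl fun i _ => ?_
    simp only [hu, hv, mul_pow]
    ring
  rw [e, ← mul_assoc]
  have hhalf : IsSumSq (C (1 / 2) : MvPolynomial (Fin n) ℝ) := isSumSq_C (by norm_num)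
  refine ((IsSumSqLimit.of_isSumSq IsSumSq.one).prod_mul J fun i => N - J i).isSumSq_mul
    ((isSumSq_C hcoeff).mul (IsSumSq.prod fun i _ => ?_))
  exact (IsSumSq.natCast _).mul ((isSumSq_pow hhalf _).mul (isSumSq_pow hhalf _))

theorem isSumSqLimit_of_nonneg {f : MvPolynomial (Fin n) ℝ}
    (hf : ∀ x : Fin n → ℝ, (∀ i, x i ∈ Set.Icc (-1 : ℝ) 1) → 0 ≤ eval x f) :
    IsSumSqLimit f := by
  refine IsSumSqLimit.of_forall_add_C fun η hη => isSumSqLimit_of_pos hη fun x hx => ?_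
  rw [map_add, eval_C]
  linarith [hf x hx]

/-! ### Degree bounds and the truncated pre-ordering -/

theorem sosPerturbation_eq (f : MvPolynomial (Fin n) ℝ) (ε : ℝ) (s : ℕ) :
    sosPerturbation f ε s = f + C ε * powerSum n s := by
  rw [powerSum_eq, sosPerturbation]

theorem totalDegree_powerSum_le (n s : ℕ) : (powerSum n s).totalDegree ≤ 2 * s := by
  rw [powerSum_eq]
  refine (totalDegree_add _ _).trans (max_le (by simp) ?_)
  refine totalDegree_finsetSum_le fun i _ => ?_
  rw [totalDegree_X_pow]

theorem exists_sosPerturbation_mem {f : MvPolynomial (Fin n) ℝ}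
    (hf : ∀ x : Fin n → ℝ, (∀ i, x i ∈ Set.Icc (-1 : ℝ) 1) → 0 ≤ eval x f)
    {ε : ℝ} (hε : 0 < ε) : ∃ s, sosPerturbation f ε s ∈ sosTruncated n (2 * s) := by
  obtain ⟨s₀, h⟩ := (isSumSqLimit_of_nonneg hf).exists_forall_ge hε
  -- The second entry keeps the degree of `f` below `2 s`, as membership in `sosTruncated` requires.
  refine ⟨max s₀ f.totalDegree, ?_⟩
  rw [sosPerturbation_eq]
  refine ⟨h _ (le_max_left _ _), (totalDegree_add _ _).trans (max_le ?_ ?_)⟩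
  · have := le_max_right s₀ f.totalDegree
    omega
  · refine (totalDegree_mul _ _).trans ?_
    rw [totalDegree_C, zero_add]
    exact totalDegree_powerSum_le n _

section TruncatedPreordering

variable {ι : Type*} [Fintype ι] {g : ι → MvPolynomial (Fin n) ℝ} {r : ℕ}

theorem truncatedPreordering_zero_mem : 0 ∈ truncatedPreordering g r :=
  ⟨0, fun _ => IsSumSq.zero, fun _ => by simp, by simp⟩

theorem truncatedPreordering_add_mem {p q : MvPolynomial (Fin n) ℝ}
    (hp : p ∈ truncatedPreordering g r) (hq : q ∈ truncatedPreordering g r) :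
    p + q ∈ truncatedPreordering g r := by
  obtain ⟨σ, hσ, hσr, rfl⟩ := hp
  obtain ⟨τ, hτ, hτr, rfl⟩ := hq
  refine ⟨σ + τ, fun I => (hσ I).add (hτ I), fun I => ?_, ?_⟩
  · rw [Pi.add_apply, add_mul]
    exact (totalDegree_add _ _).trans (max_le (hσr I) (hτr I))
  · simp only [Pi.add_apply, add_mul, Finset.sum_add_distrib]

theorem mul_prod_mem_truncatedPreordering {σ : MvPolynomial (Fin n) ℝ} (hσ : IsSumSq σ)
    (I : Finset ι) (hr : (σ * ∏ i ∈ I, g i).totalDegree ≤ r) :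
    σ * ∏ i ∈ I, g i ∈ truncatedPreordering g r := by
  classical
  refine ⟨Pi.single I σ, fun J => ?_, fun J => ?_, ?_⟩
  · rcases eq_or_ne J I with rfl | h
    · simpa using hσ
    · simp [h]
  · rcases eq_or_ne J I with rfl | h
    · simpa using hr
    · simp [h]
  · rw [Finset.sum_eq_single I (fun J _ h => by simp [h]) (by simp)]
    simp

end TruncatedPreordering

/-- A geometric sum in `x_i ^ 2` times the product of the two generators for `i`; only this one
subset contributes. -/
theorem one_sub_pow_mem_truncatedPreordering {ε : ℝ} (hε : 0 ≤ ε) (s : ℕ) (i : Fin n) :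
    C ε * (1 - X i ^ (2 * s)) ∈ truncatedPreordering (cubeGenerators n) (2 * s) := by
  classical
  have hprod : ∏ j ∈ ({Sum.inl i, Sum.inr i} : Finset (Fin n ⊕ Fin n)), cubeGenerators n j =
      1 - X i ^ 2 := by
    rw [Finset.prod_pair (by simp)]
    simp only [cubeGenerators, Sum.elim_inl, Sum.elim_inr]
    ring
  have h : C ε * (1 - X i ^ (2 * s)) = (C ε * ∑ k ∈ Finset.range s, (X i ^ 2) ^ k) *
      ∏ j ∈ ({Sum.inl i, Sum.inr i} : Finset (Fin n ⊕ Fin n)), cubeGenerators n j := by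
    rw [hprod, mul_assoc, geom_sum_mul_neg, pow_mul]
  rw [h]
  refine mul_prod_mem_truncatedPreordering
    ((isSumSq_C hε).mul (IsSumSq.sum fun k _ => isSumSq_pow (isSumSq_sq _) k)) _ ?_
  rw [← h]
  refine (totalDegree_mul _ _).trans ?_
  rw [totalDegree_C, zero_add]
  refine (totalDegree_sub _ _).trans (max_le (by simp) ?_)
  rw [totalDegree_X_pow]

theorem theorem4 (n : ℕ) (f : MvPolynomial (Fin n) ℝ)
    (hf : ∀ x : Fin n → ℝ, (∀ i, x i ∈ Set.Icc (-1 : ℝ) 1) → 0 ≤ MvPolynomial.eval x f)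
    (ε : ℝ) (hε : 0 < ε) :
    ∃ rε : ℕ, IsLeast {s : ℕ | sosPerturbation f ε s ∈ sosTruncated n (2 * s)} rε ∧
      ∃ r : ℕ, r ≤ rε ∧
        f + MvPolynomial.C (((n : ℝ) + 1) * ε) ∈
          truncatedPreordering (cubeGenerators n) (2 * r) := by
  classical
  have hex := exists_sosPerturbation_mem hf hε
  refine ⟨Nat.find hex, ⟨Nat.find_spec hex, fun s hs => Nat.find_min' hex hs⟩,
    Nat.find hex, le_rfl, ?_⟩
  obtain ⟨hsos, hdeg⟩ := Nat.find_spec hex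
  set s := Nat.find hex
  -- The perturbation is the term of the empty subset; the other summands cancel its powers `x_i ^
  -- (2 s)` and leave `n ε`.
  have h : f + C (((n : ℝ) + 1) * ε) =
      sosPerturbation f ε s * ∏ j ∈ (∅ : Finset (Fin n ⊕ Fin n)), cubeGenerators n j +
        ∑ i : Fin n, C ε * (1 - X i ^ (2 * s)) := by
    rw [Finset.prod_empty, mul_one, ← Finset.mul_sum, Finset.sum_sub_distrib, sosPerturbation]
    simp only [Finset.sum_const, Finset.card_univ, Fintype.card_fin, nsmul_eq_mul, C_mul, C_add,
      C_1, map_natCast]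
    ring
  rw [h]
  refine truncatedPreordering_add_mem (mul_prod_mem_truncatedPreordering hsos ∅ ?_) ?_
  · rwa [Finset.prod_empty, mul_one]
  · exact Finset.sum_induction _ (· ∈ truncatedPreordering (cubeGenerators n) (2 * s))
      (fun _ _ => truncatedPreordering_add_mem) truncatedPreordering_zero_mem
      fun i _ => one_sub_pow_mem_truncatedPreordering hε.le s i
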